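/- Let $M$ be a matroid on a finite ground set $E(M)$ with rank function $r$, and let $\eta(X)=|X|-r(X)$ denote the nullity of $X\subseteq E(M)$. A *cyclic flat* of $M$ is a flat that is a (possibly empty) union of circuits; let $\mathcal Z(M)$ be the set of cyclic flats, ordered by inclusion. An *antichain* in $\mathcal Z(M)$ is a set $\mathcal F\subseteq\mathcal Z(M)$ no two distinct members of which are related by inclusion, and an *ideal* in $\mathcal Z(M)$ is a set $\mathcal F\subseteq\mathcal Z(M)$ such that $B\in\mathcal F$, $A\in\mathcal Z(M)$ and $A\subseteq B$ imply $A\in\mathcal F$. Write $\cup\mathcal F$ and $\cap\mathcal F$ for the union and the intersection of the sets in $\mathcal F$ (with $\cup\emptyset=\emptyset$). Mason's function $\alpha$ is defined recursively for $X\subseteq E(M)$ by $$\alpha(X)=\eta(X)-\sum_{\text{flats }F\,:\,F\subsetneq X}\alpha(F).$$ A *partial transversal* of a finite family $(A_1,\dots,A_k)$ of subsets of $E(M)$ is a set $I\subseteq E(M)$ for which there is an injection $\phi:I\to\{1,\dots,k\}$ with $x\in A_{\phi(x)}$ for all $x\in I$. The matroid $M$ is a *fundamental transversal matroid* if there are $k\ge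 0$ and a family $(A_1,\dots,A_k)$ of subsets of $E(M)$ whose partial transversals are exactly the independent sets of $M$ and for which every difference $A_i-\bigcup_{j\ne i}A_j$ is nonempty. Then the following statements are equivalent: 1. $M$ is a fundamental transversal matroid; 2. for all subsets $\mathcal F$ of $\mathcal Z(M)$, $$r(\cup\mathcal F)=\sum_{\emptyset\ne\mathcal F'\subseteq\mathcal F}(-1)^{|\mathcal F'|+1}\,r(\cap\mathcal F');\qquad(*)$$ 3. equation $(*)$ holds for all ideals $\mathcal F$ in $\mathcal Z(M)$; 4. equation $(*)$ holds for all antichains $\mathcal F$ in $\mathcal Z(M)$; 5. for all ideals $\mathcal F$ in $\mathcal Z(M)$, $$\sum_{Y\in\mathcal F}\alpha(Y)=\eta(\cup\mathcal F).$$ -/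

import Mathlib

namespace Matroid

/-- The rank `r(X)` of a set `X` in a matroid, as an integer. (In a finite matroid all ranks are
finite, so nothing is lost in passing from `ℕ∞` to `ℤ`.) -/
noncomputable def intRk {α : Type*} (M : Matroid α) (X : Set α) : ℤ :=
  ((M.eRk X).toNat : ℤ)

/-- The nullity `η(X) = |X| - r(X)` of a (finite) set `X` in a matroid. -/
noncomputable def intNullity {α : Type*} (M : Matroid α) (X : Set α) : ℤ :=
  (X.ncard : ℤ) - M.intRk X

/-- A cyclic flat is a flat that is a (possibly empty) union of circuits. The cyclic flats of `M`
are the elements of the lattice `𝒵(M)`, ordered by inclusion. -/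
def IsCyclicFlat {α : Type*} (M : Matroid α) (F : Set α) : Prop :=
  M.IsFlat F ∧ ∃ 𝒞 : Set (Set α), (∀ C ∈ 𝒞, M.IsCircuit C) ∧ F = ⋃₀ 𝒞

/-- `I` is a partial transversal of the set system `(A i)_{i ∈ ι}`: there is an injection
`φ : I → ι` with `x ∈ A (φ x)` for all `x ∈ I`. -/
def IsPartialTransversal {α ι : Type*} (A : ι → Set α) (I : Set α) : Prop :=
  ∃ φ : I → ι, Function.Injective φ ∧ ∀ x : I, (x : α) ∈ A (φ x)

/-- The set system `A` on the ground set of `M` is a presentation of `M`: the independent sets of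
`M` are exactly the partial transversals of `A`. -/
def IsPresentation {α ι : Type*} (M : Matroid α) (A : ι → Set α) : Prop :=
  (∀ i, A i ⊆ M.E) ∧ ∀ I : Set α, M.Indep I ↔ I ⊆ M.E ∧ IsPartialTransversal A I

/-- `M` is a fundamental transversal matroid: it is the transversal matroid of a finite set system
`(A_1, …, A_r)` in which no difference `A_i - ⋃_{j ≠ i} A_j` is empty. -/
def IsFundamentalTransversal {α : Type*} (M : Matroid α) : Prop :=
  ∃ (r : ℕ) (A : Fin r → Set α), M.IsPresentation A ∧
    ∀ i : Fin r, (A i \ ⋃ (j : Fin r) (_ : j ≠ i), A j).Nonempty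

/-- `𝓕` is a subset of the lattice of cyclic flats of `M`. (For a finite matroid this lattice is
finite, so all its subsets are finite.) -/
def IsCyclicFlatSet {α : Type*} (M : Matroid α) (𝓕 : Finset (Set α)) : Prop :=
  ∀ F ∈ 𝓕, M.IsCyclicFlat F

/-- `𝓕` is an ideal (a down-closed subset) of the lattice of cyclic flats of `M`. -/
def IsCyclicFlatIdeal {α : Type*} (M : Matroid α) (𝓕 : Finset (Set α)) : Prop :=
  M.IsCyclicFlatSet 𝓕 ∧ ∀ B ∈ 𝓕, ∀ A : Set α, M.IsCyclicFlat A → A ⊆ B → A ∈ 𝓕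

/-- `𝓕` is an antichain of the lattice of cyclic flats of `M`. -/
def IsCyclicFlatAntichain {α : Type*} (M : Matroid α) (𝓕 : Finset (Set α)) : Prop :=
  M.IsCyclicFlatSet 𝓕 ∧ IsAntichain (· ⊆ ·) (𝓕 : Set (Set α))

/-- The equation `r(⋃ 𝓕) = ∑_{∅ ≠ 𝓖 ⊆ 𝓕} (-1)^(|𝓖| + 1) r(⋂ 𝓖)`. -/
def RankUnionEq {α : Type*} (M : Matroid α) (𝓕 : Finset (Set α)) : Prop :=
  M.intRk (⋃₀ (𝓕 : Set (Set α))) =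
    ∑ 𝓖 ∈ 𝓕.powerset with 𝓖.Nonempty,
      (-1 : ℤ) ^ (𝓖.card + 1) * M.intRk (⋂₀ (𝓖 : Set (Set α)))

theorem finite_setOf_isFlat_ssubset {α : Type*} (M : Matroid α) [M.Finite] (X : Set α) :
    {F : Set α | M.IsFlat F ∧ F ⊂ X}.Finite :=
  M.ground_finite.finite_subsets.subset fun _ hF => hF.1.subset_ground

/-- The finite set of flats `F` of a finite matroid that are properly contained in `X`. -/
noncomputable def flatsSSubset {α : Type*} (M : Matroid α) [M.Finite] (X : Set α) :
    Finset (Set α) :=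
  (M.finite_setOf_isFlat_ssubset X).toFinset

theorem mem_flatsSSubset {α : Type*} (M : Matroid α) [M.Finite] {X F : Set α} :
    F ∈ M.flatsSSubset X ↔ M.IsFlat F ∧ F ⊂ X := by
  simp [flatsSSubset]

/-- Mason's function `α`, defined recursively by
`α(X) = η(X) - ∑ α(F)`, the sum being over all flats `F` properly contained in `X`. -/
noncomputable def masonAlpha {α : Type*} (M : Matroid α) [M.Finite] (X : Set α) : ℤ :=
  M.intNullity X - ∑ F ∈ (M.flatsSSubset X).attach, M.masonAlpha F.1
termination_by X.encard
decreasing_by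
  have h := M.mem_flatsSSubset.1 F.2
  exact (M.ground_finite.subset h.1.subset_ground).encard_lt_encard h.2

theorem masonAlpha_eq {α : Type*} (M : Matroid α) [M.Finite] (X : Set α) :
    M.masonAlpha X = M.intNullity X - ∑ F ∈ M.flatsSSubset X, M.masonAlpha F := by
  rw [masonAlpha, Finset.sum_attach (M.flatsSSubset X) (fun F => M.masonAlpha F)]

end Matroid

/-! All five conditions amount to the existence of an independent set `B` with `F ⊆ cl(B ∩ F)` for
every cyclic flat `F`. Private elements of a fundamental presentation form such a `B`
(`IsFundamentalTransversal.exists_indep`), and Hall's theorem turns such a `B` back into a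
presentation (`IsFundamentalTransversal.of_indep`). Given `B`, rank counts elements of `B` on unions
and nonempty intersections of cyclic flats, so (*) is inclusion-exclusion for cardinalities
(`Indep.rankUnionEq`).

On flats, η is the sum of α over the cyclic flats below, so weighted inclusion-exclusion turns (*)
for an ideal into the α identity. That identity in turn forces 0 ≤ α(I) ≤ |I \ U|, where `U` is the
union of the cyclic flats not containing `I`; deleting α(I) elements of `I \ U` from the ground set,
for every cyclic flat `I`, leaves `B` (`exists_indep_of_sum_masonAlpha`). -/

namespace Finset

/-! ### Alternating sums over nonempty subfamilies -/

theorem sum_powerset_nonempty_neg_one_pow {β : Type*} (𝓕 : Finset β) (h : 𝓕.Nonempty) :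
    ∑ 𝓖 ∈ 𝓕.powerset with 𝓖.Nonempty, (-1 : ℤ) ^ (𝓖.card + 1) = 1 := by
  classical
  have h0 := sum_powerset_neg_one_pow_card_of_nonempty h
  have h1 : 𝓕.powerset.filter (·.Nonempty) = 𝓕.powerset.erase ∅ := by
    ext 𝓖
    simp [nonempty_iff_ne_empty, and_comm]
  have h2 := add_sum_erase 𝓕.powerset (fun 𝓖 => (-1 : ℤ) ^ 𝓖.card) (empty_mem_powerset 𝓕)
  rw [h1]
  simp only [pow_succ, ← sum_mul]
  rw [h0] at h2
  simp only [card_empty, pow_zero] at h2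
  linarith

/-- Weighted inclusion-exclusion for the sets `{y | R y G}`, `G ∈ 𝓕`. -/
theorem sum_powerset_nonempty_mul_sum_filter {β γ : Type*} (R : γ → β → Prop) (s : Finset γ)
    (w : γ → ℤ) (𝓕 : Finset β) [∀ 𝓖 : Finset β, DecidablePred fun y => ∀ G ∈ 𝓖, R y G]
    [DecidablePred fun y => ∃ G ∈ 𝓕, R y G] :
    ∑ 𝓖 ∈ 𝓕.powerset with 𝓖.Nonempty,
        (-1 : ℤ) ^ (𝓖.card + 1) * ∑ y ∈ s with ∀ G ∈ 𝓖, R y G, w y =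
      ∑ y ∈ s with ∃ G ∈ 𝓕, R y G, w y := by
  classical
  simp only [sum_filter _ w, mul_sum]
  rw [sum_comm]
  refine sum_congr rfl fun y _ => ?_
  simp only [mul_ite, mul_zero]
  rw [← sum_filter, filter_filter, ← sum_mul]
  have h1 : 𝓕.powerset.filter (fun 𝓖 => 𝓖.Nonempty ∧ ∀ G ∈ 𝓖, R y G) =
      (𝓕.filter (R y)).powerset.filter (·.Nonempty) := by
    ext 𝓖
    simp only [mem_filter, mem_powerset, subset_iff]
    grind
  rw [h1]
  split_ifs with h
  · rw [sum_powerset_nonempty_neg_one_pow, one_mul]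
    obtain ⟨G, hG, hy⟩ := h
    exact ⟨G, by simp [hG, hy]⟩
  · rw [sum_eq_zero, zero_mul]
    intro 𝓖 h𝓖
    simp only [mem_filter, mem_powerset] at h𝓖
    obtain ⟨G, hG⟩ := h𝓖.2
    exact absurd ⟨G, by simpa using h𝓖.1 hG⟩ h

end Finset

namespace Matroid

open Set

variable {α : Type*}

/-! ### Integer rank and nullity -/

theorem IsBasis.intRk_eq_ncard {M : Matroid α} {I X : Set α} (h : M.IsBasis I X) :
    M.intRk X = I.ncard := by
  rw [intRk, h.eRk_eq_encard, ncard_def]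

theorem intRk_mono (M : Matroid α) [M.Finite] {X Y : Set α} (h : X ⊆ Y) :
    M.intRk X ≤ M.intRk Y := by
  rw [intRk, intRk, Nat.cast_le]
  exact ENat.toNat_le_toNat (M.eRk_mono h) (eRk_ne_top_iff.2 (M.isRkFinite_set Y))

theorem intNullity_mono (M : Matroid α) [M.Finite] {X Y : Set α} (h : X ⊆ Y) (hY : Y ⊆ M.E) :
    M.intNullity X ≤ M.intNullity Y := by
  have hYf := M.set_finite Y hY
  have h1 : (M.eRk Y).toNat ≤ (M.eRk X + (Y \ X).encard).toNat := by
    refine ENat.toNat_le_toNat ?_ ?_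
    · simpa [union_sdiff_cancel h] using M.eRk_union_le_eRk_add_encard X (Y \ X)
    · exact WithTop.add_ne_top.2 ⟨eRk_ne_top_iff.2 (M.isRkFinite_set X),
        (hYf.subset sdiff_subset).encard_lt_top.ne⟩
  rw [ENat.toNat_add (eRk_ne_top_iff.2 (M.isRkFinite_set X))
    (hYf.subset sdiff_subset).encard_lt_top.ne, ← ncard_def] at h1
  have h2 := ncard_sdiff_add_ncard_of_subset h hYf
  simp only [intNullity, intRk]
  omega

/-! ### Cyclic flats and Mason's function -/

theorem isCyclicFlat_iff {M : Matroid α} {F : Set α} :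
    M.IsCyclicFlat F ↔ M.IsFlat F ∧ ∀ e ∈ F, ∃ C ⊆ F, M.IsCircuit C ∧ e ∈ C := by
  refine and_congr_right fun _ => ⟨?_, fun h => ?_⟩
  · rintro ⟨𝒞, h𝒞, rfl⟩ e ⟨C, hC, he⟩
    exact ⟨C, subset_sUnion_of_mem hC, h𝒞 C hC, he⟩
  · refine ⟨{C | C ⊆ F ∧ M.IsCircuit C}, fun C hC => hC.2, subset_antisymm ?_ ?_⟩
    · intro e he
      obtain ⟨C, hCF, hC, heC⟩ := h e he
      exact ⟨C, ⟨hCF, hC⟩, heC⟩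
    · exact sUnion_subset fun C hC => hC.1

theorem IsCircuit.isCyclicFlat_closure {M : Matroid α} {C : Set α} (hC : M.IsCircuit C) :
    M.IsCyclicFlat (M.closure C) := by
  refine isCyclicFlat_iff.2 ⟨M.isFlat_closure C, fun e he => ?_⟩
  have hss := M.subset_closure C hC.subset_ground
  by_cases heC : e ∈ C
  · exact ⟨C, hss, hC, heC⟩
  · obtain ⟨D, hD, hDc, heD⟩ := (mem_closure_iff_exists_isCircuit heC).1 he
    exact ⟨D, hD.trans (insert_subset he hss), hDc, heD⟩

/-- The finite set of cyclic flats of a finite matroid. -/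
noncomputable def cyclicFlats (M : Matroid α) [M.Finite] : Finset (Set α) :=
  (M.ground_finite.finite_subsets.subset
    (fun _ hF => hF.1.subset_ground : {F | M.IsCyclicFlat F} ⊆ {F | F ⊆ M.E})).toFinset

@[simp]
theorem mem_cyclicFlats (M : Matroid α) [M.Finite] {F : Set α} :
    F ∈ M.cyclicFlats ↔ M.IsCyclicFlat F := by
  simp [cyclicFlats]

/-- Some `e ∈ X` lies in no circuit inside `X`, so it is a coloop of the restriction to `X`.
Deleting it changes neither the nullity nor the cyclic flats below, which drives the induction on
flats. -/
theorem IsFlat.exists_sdiff_singleton_of_not_isCyclicFlat {M : Matroid α} {X : Set α}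
    (hX : M.IsFlat X) (hc : ¬ M.IsCyclicFlat X) :
    ∃ e ∈ X, e ∉ M.closure (X \ {e}) ∧ M.IsFlat (X \ {e}) ∧
      ∀ Y, M.IsCyclicFlat Y → Y ⊆ X → Y ⊆ X \ {e} := by
  simp only [isCyclicFlat_iff, hX, true_and, not_forall, not_exists, not_and] at hc
  obtain ⟨e, he, h⟩ := hc
  have hcl : e ∉ M.closure (X \ {e}) := by
    intro hcl
    obtain ⟨C, hC, hCc, heC⟩ := (mem_closure_iff_exists_isCircuit (by simp)).1 hcl
    exact h C (by simpa [insert_eq_of_mem he] using hC) hCc heC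
  refine ⟨e, he, hcl, isFlat_iff_closure_eq.2 (subset_antisymm ?_
    (M.subset_closure _ (sdiff_subset.trans hX.subset_ground))), fun Y hY hYX => ?_⟩
  · refine subset_sdiff_singleton ?_ hcl
    exact (M.closure_subset_closure sdiff_subset).trans hX.closure.subset
  · refine subset_sdiff_singleton hYX fun heY => ?_
    obtain ⟨C, hC, hCc, heC⟩ := (isCyclicFlat_iff.1 hY).2 e heY
    exact h C (hC.trans hYX) hCc heC

theorem intNullity_sdiff_singleton (M : Matroid α) [M.Finite] {X : Set α} {e : α} (hX : X ⊆ M.E)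
    (he : e ∈ X) (hcl : e ∉ M.closure (X \ {e})) :
    M.intNullity (X \ {e}) = M.intNullity X := by
  have h1 := M.eRk_insert_eq_add_one ⟨hX he, hcl⟩
  rw [insert_sdiff_singleton, insert_eq_of_mem he] at h1
  have h2 := ncard_sdiff_singleton_add_one he (M.set_finite X hX)
  have h3 : (M.eRk X).toNat = (M.eRk (X \ {e})).toNat + 1 := by
    rw [h1, ENat.toNat_add (eRk_ne_top_iff.2 (M.isRkFinite_set _)) (by simp)]
    simp
  simp only [intNullity, intRk]
  omega

open Classical in
theorem sum_masonAlpha_flatsSSubset (M : Matroid α) [M.Finite] (X : Set α)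
    (h : ∀ F ⊂ X, M.IsFlat F → ¬ M.IsCyclicFlat F → M.masonAlpha F = 0) :
    ∑ F ∈ M.flatsSSubset X, M.masonAlpha F =
      ∑ Y ∈ M.cyclicFlats with Y ⊂ X, M.masonAlpha Y := by
  refine (Finset.sum_subset (fun Y hY => ?_) fun F hF hF' => ?_).symm
  · simp only [Finset.mem_filter, mem_cyclicFlats] at hY
    exact M.mem_flatsSSubset.2 ⟨hY.1.1, hY.2⟩
  · rw [mem_flatsSSubset] at hF
    simp only [Finset.mem_filter, mem_cyclicFlats, not_and'] at hF'
    exact h F hF.2 hF.1 (hF' hF.2)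

-- The two claims need each other: vanishing of α on smaller noncyclic flats reduces the recursion
-- to cyclic flats, and the sum formula for `X` minus a coloop leaves nothing for α(X) when `X` is
-- not cyclic.
open Classical in
theorem IsFlat.masonAlpha_aux (M : Matroid α) [M.Finite] (n : ℕ) (X : Set α) (hn : X.ncard = n)
    (hX : M.IsFlat X) :
    ∑ Y ∈ M.cyclicFlats with Y ⊆ X, M.masonAlpha Y = M.intNullity X ∧
      (¬ M.IsCyclicFlat X → M.masonAlpha X = 0) := by
  induction n using Nat.strong_induction_on generalizing X with
  | _ n ih =>
    subst hn
    have hXf := M.set_finite X hX.subset_ground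
    have h1 := M.sum_masonAlpha_flatsSSubset X fun F hF hFf hFc =>
      (ih _ (ncard_lt_ncard hF hXf) F rfl hFf).2 hFc
    have h2 := M.masonAlpha_eq X
    rw [h1] at h2
    by_cases hc : M.IsCyclicFlat X
    · refine ⟨?_, fun h => absurd hc h⟩
      have h3 : M.cyclicFlats.filter (· ⊆ X) = insert X (M.cyclicFlats.filter (· ⊂ X)) := by
        ext Y
        simp only [Finset.mem_filter, mem_cyclicFlats, Finset.mem_insert, subset_iff_ssubset_or_eq]
        constructor
        · rintro ⟨h, h' | h'⟩ <;> simp [*]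
        · rintro (rfl | ⟨h, h'⟩) <;> simp [*]
      rw [h3, Finset.sum_insert (by simp), h2]
      ring
    · obtain ⟨e, he, hcl, hfl, hY⟩ := hX.exists_sdiff_singleton_of_not_isCyclicFlat hc
      have h3 := (ih _ (ncard_lt_ncard (sdiff_singleton_ssubset.2 he) hXf) _ rfl hfl).1
      rw [M.intNullity_sdiff_singleton hX.subset_ground he hcl] at h3
      have h4 : M.cyclicFlats.filter (· ⊆ X \ {e}) = M.cyclicFlats.filter (· ⊆ X) := by
        refine Finset.filter_congr fun Y hYc => ⟨fun h => h.trans sdiff_subset, ?_⟩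
        exact hY Y (by simpa using hYc)
      have h5 : M.cyclicFlats.filter (· ⊂ X) = M.cyclicFlats.filter (· ⊆ X) := by
        refine Finset.filter_congr fun Y hYc => ⟨fun h => h.subset, fun h => h.ssubset_of_ne ?_⟩
        rintro rfl
        exact hc (by simpa using hYc)
      rw [h4] at h3
      refine ⟨h3, fun _ => ?_⟩
      rw [h2, h5, h3, sub_self]

open Classical in
/-- On flats, the nullity is the sum of Mason's function over the cyclic flats below. -/
theorem IsFlat.sum_masonAlpha {M : Matroid α} [M.Finite] {X : Set α} (hX : M.IsFlat X) :
    ∑ Y ∈ M.cyclicFlats with Y ⊆ X, M.masonAlpha Y = M.intNullity X :=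
  (IsFlat.masonAlpha_aux M _ X rfl hX).1

/-! ### Reduction to antichains -/

/-- The subfamilies containing `A` pair off by adding or removing `B`: as `A ∩ B = A`, the
intersection is unchanged while the sign flips. -/
theorem RankUnionEq.of_erase {M : Matroid α} [DecidableEq (Set α)] {𝓕 : Finset (Set α)}
    {A B : Set α} (hA : A ∈ 𝓕) (hB : B ∈ 𝓕) (hne : A ≠ B) (hAB : A ⊆ B)
    (h : M.RankUnionEq (𝓕.erase A)) : M.RankUnionEq 𝓕 := by
  have hU : ⋃₀ (𝓕 : Set (Set α)) = ⋃₀ ((𝓕.erase A : Finset (Set α)) : Set (Set α)) := by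
    refine subset_antisymm (sUnion_subset fun X hX => ?_) (sUnion_subset_sUnion (by simp))
    by_cases hXA : X = A
    · subst hXA
      exact hAB.trans (subset_sUnion_of_mem (by simp [hB, hne.symm]))
    · exact subset_sUnion_of_mem (by simpa [hXA] using hX)
  obtain ⟨𝓔, hA𝓔, hB𝓔, rfl⟩ : ∃ 𝓔 : Finset (Set α), A ∉ insert B 𝓔 ∧ B ∉ 𝓔 ∧
      𝓕 = insert A (insert B 𝓔) := by
    refine ⟨(𝓕.erase A).erase B, ?_, by simp, ?_⟩ <;> grind
  rw [RankUnionEq, hU]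
  rw [Finset.erase_insert hA𝓔] at h ⊢
  rw [RankUnionEq] at h
  rw [h, Finset.sum_filter, Finset.sum_filter, Finset.sum_powerset_insert hA𝓔, left_eq_add,
    Finset.sum_powerset_insert hB𝓔, ← Finset.sum_add_distrib]
  refine Finset.sum_eq_zero fun 𝓖 h𝓖 => ?_
  have hB' : B ∉ 𝓖 := fun hx => hB𝓔 (Finset.mem_powerset.1 h𝓖 hx)
  have hA' : A ∉ insert B 𝓖 := fun hx =>
    hA𝓔 (Finset.insert_subset_insert B (Finset.mem_powerset.1 h𝓖) hx)
  have hA'' : A ∉ 𝓖 := fun hx => hA' (Finset.mem_insert_of_mem hx)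
  have hI : A ∩ (B ∩ ⋂₀ (𝓖 : Set (Set α))) = A ∩ ⋂₀ (𝓖 : Set (Set α)) := by
    rw [← inter_assoc, inter_eq_left.2 hAB]
  simp only [Finset.insert_nonempty, if_true, Finset.card_insert_of_notMem hA',
    Finset.card_insert_of_notMem hA'', Finset.card_insert_of_notMem hB', Finset.coe_insert,
    sInter_insert, hI]
  ring

theorem rankUnionEq_of_antichain {M : Matroid α}
    (h : ∀ 𝓕 : Finset (Set α), M.IsCyclicFlatAntichain 𝓕 → M.RankUnionEq 𝓕)
    (𝓕 : Finset (Set α)) (h𝓕 : M.IsCyclicFlatSet 𝓕) : M.RankUnionEq 𝓕 := by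
  classical
  induction 𝓕 using Finset.strongInduction with
  | H 𝓕 ih =>
    by_cases ha : IsAntichain (· ⊆ ·) (𝓕 : Set (Set α))
    · exact h 𝓕 ⟨h𝓕, ha⟩
    · simp only [IsAntichain, Set.Pairwise, not_forall] at ha
      obtain ⟨A, hA, B, hB, hne, hAB⟩ := ha
      refine RankUnionEq.of_erase hA hB hne (by simpa using hAB) (ih _ (Finset.erase_ssubset hA) ?_)
      exact fun F hF => h𝓕 F (Finset.mem_of_mem_erase hF)

/-! ### Inclusion-exclusion for cardinality, nullity and rank -/

open Classical in
theorem ncard_eq_sum_filter {s : Finset α} {X : Set α} (h : X ⊆ s) :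
    (X.ncard : ℤ) = ∑ y ∈ s with y ∈ X, 1 := by
  rw [Finset.sum_const, nsmul_one, Nat.cast_inj, ← ncard_coe_finset]
  congr 1
  ext y
  simpa using @h y

/-- Inclusion-exclusion for the cardinality of a union of subsets of a finite set. -/
theorem ncard_inter_sUnion {B : Set α} (hB : B.Finite) (𝓕 : Finset (Set α)) :
    ((B ∩ ⋃₀ (𝓕 : Set (Set α))).ncard : ℤ) = ∑ 𝓖 ∈ 𝓕.powerset with 𝓖.Nonempty,
      (-1 : ℤ) ^ (𝓖.card + 1) * ((B ∩ ⋂₀ (𝓖 : Set (Set α))).ncard : ℤ) := by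
  classical
  have h := Finset.sum_powerset_nonempty_mul_sum_filter (fun (y : α) (G : Set α) => y ∈ G)
    hB.toFinset (fun _ => 1) 𝓕
  have hi : ∀ X : Set α, ((B ∩ X).ncard : ℤ) = ∑ y ∈ hB.toFinset with y ∈ X, 1 := by
    intro X
    rw [ncard_eq_sum_filter (s := hB.toFinset) (by simp)]
    congr 1
    ext y
    simp
  simp only [hi, mem_sInter, mem_sUnion, Finset.mem_coe]
  exact h.symm

theorem isFlat_sInter {M : Matroid α} {𝓖 : Finset (Set α)} (hne : 𝓖.Nonempty)
    (h : ∀ G ∈ 𝓖, M.IsFlat G) : M.IsFlat (⋂₀ (𝓖 : Set (Set α))) := by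
  have := hne.coe_sort
  rw [sInter_eq_iInter]
  exact IsFlat.iInter fun G => h G.1 G.2

/-- Subtracting (*) from inclusion-exclusion for cardinality leaves signed nullities of
intersections. These are flats, so each is a sum of α over cyclic flats below it, and the signed
total counts once each cyclic flat below a member of the ideal. -/
theorem IsCyclicFlatIdeal.sum_masonAlpha {M : Matroid α} [M.Finite] {𝓕 : Finset (Set α)}
    (h𝓕 : M.IsCyclicFlatIdeal 𝓕) (h : M.RankUnionEq 𝓕) :
    ∑ Y ∈ 𝓕, M.masonAlpha Y = M.intNullity (⋃₀ (𝓕 : Set (Set α))) := by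
  classical
  have hsub : ∀ G ∈ 𝓕, G ⊆ M.E := fun G hG => (h𝓕.1 G hG).1.subset_ground
  have h1 := ncard_inter_sUnion M.ground_finite 𝓕
  rw [inter_eq_right.2 (sUnion_subset hsub)] at h1
  rw [intNullity, h1, h, ← Finset.sum_sub_distrib]
  have h2 := Finset.sum_powerset_nonempty_mul_sum_filter (fun (Y : Set α) (G : Set α) => Y ⊆ G)
    M.cyclicFlats M.masonAlpha 𝓕
  have h3 : M.cyclicFlats.filter (fun Y => ∃ G ∈ 𝓕, Y ⊆ G) = 𝓕 := by
    ext Y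
    simp only [Finset.mem_filter, mem_cyclicFlats]
    exact ⟨fun ⟨hY, G, hG, hYG⟩ => h𝓕.2 G hG Y hY hYG, fun hY => ⟨h𝓕.1 Y hY, Y, hY, subset_rfl⟩⟩
  rw [h3] at h2
  rw [← h2]
  refine Finset.sum_congr rfl fun 𝓖 h𝓖 => ?_
  simp only [Finset.mem_filter, Finset.mem_powerset] at h𝓖
  have hfl := isFlat_sInter h𝓖.2 fun G hG => (h𝓕.1 G (h𝓖.1 hG)).1
  rw [← mul_sub, inter_eq_right.2 hfl.subset_ground, ← intNullity, ← hfl.sum_masonAlpha]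
  simp only [subset_sInter_iff, Finset.mem_coe]

/-- If the independent set `B` spans every cyclic flat from within, then ranks of unions of cyclic
flats are given by inclusion-exclusion, since `r` then counts elements of `B`. -/
theorem Indep.rankUnionEq {M : Matroid α} [M.Finite] {B : Set α} (hB : M.Indep B)
    (h : ∀ F, M.IsCyclicFlat F → F ⊆ M.closure (B ∩ F)) {𝓕 : Finset (Set α)}
    (h𝓕 : M.IsCyclicFlatSet 𝓕) : M.RankUnionEq 𝓕 := by
  have hrk : ∀ X ⊆ M.closure (B ∩ X), M.intRk X = (B ∩ X).ncard := fun X hX =>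
    ((hB.subset inter_subset_left).isBasis_of_subset_of_subset_closure
      inter_subset_right hX).intRk_eq_ncard
  rw [RankUnionEq, hrk, ncard_inter_sUnion (M.set_finite B hB.subset_ground)]
  · refine Finset.sum_congr rfl fun 𝓖 h𝓖 => ?_
    simp only [Finset.mem_filter, Finset.mem_powerset] at h𝓖
    rw [hrk]
    -- Closure commutes with intersection for subsets of one independent set, so `B` also spans
    -- intersections of cyclic flats from within, though these need not be cyclic.
    have hcl := hB.closure_sInter_eq_biInter_closure_of_forall_subset
      (Js := (B ∩ ·) '' (𝓖 : Set (Set α))) (by simpa using h𝓖.2) (by simp)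
    have hI : ⋂₀ ((B ∩ ·) '' (𝓖 : Set (Set α))) = B ∩ ⋂₀ (𝓖 : Set (Set α)) := by
      obtain ⟨G, hG⟩ := h𝓖.2
      ext x
      simp only [sInter_image, mem_iInter, mem_inter_iff, mem_sInter, Finset.mem_coe]
      exact ⟨fun hx => ⟨(hx G hG).1, fun G hG => (hx G hG).2⟩, fun hx G hG => ⟨hx.1, hx.2 G hG⟩⟩
    rw [hI] at hcl
    rw [hcl]
    simp only [biInter_image, subset_iInter_iff]
    exact fun G hG => (sInter_subset_of_mem hG).trans (h G (h𝓕 G (h𝓖.1 hG)))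
  · refine sUnion_subset fun F hF => (h F (h𝓕 F hF)).trans (M.closure_subset_closure ?_)
    exact inter_subset_inter_right _ (subset_sUnion_of_mem hF)

/-! ### Fundamental presentations and spanning independent sets -/

theorem IsPartialTransversal.comp_equiv {ι κ : Type*} {A : ι → Set α} {I : Set α} (e : κ ≃ ι) :
    IsPartialTransversal (A ∘ e) I ↔ IsPartialTransversal A I := by
  constructor
  · rintro ⟨φ, hφ, h⟩
    exact ⟨e ∘ φ, e.injective.comp hφ, h⟩
  · rintro ⟨φ, hφ, h⟩
    exact ⟨e.symm ∘ φ, e.symm.injective.comp hφ, by simpa using h⟩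

/-- A presentation of a matroid with private elements yields an independent set that spans every
cyclic flat from within. -/
theorem IsFundamentalTransversal.exists_indep {M : Matroid α} (hM : M.IsFundamentalTransversal) :
    ∃ B, M.Indep B ∧ ∀ F, M.IsCyclicFlat F → F ⊆ M.closure (B ∩ F) := by
  obtain ⟨r, A, ⟨hAE, hA⟩, hpriv⟩ := hM
  choose b hb using hpriv
  have hbA : ∀ i j, b i ∈ A j → j = i := fun i j hij => by
    by_contra hne
    exact (hb i).2 (mem_iUnion₂.2 ⟨j, hne, hij⟩)
  have hbmem : ∀ i, b i ∈ A i := fun i => (hb i).1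
  have hB : M.Indep (range b) := by
    refine (hA _).2 ⟨range_subset_iff.2 fun i => hAE i (hbmem i), fun x => x.2.choose, ?_, ?_⟩
    · intro x y hxy
      rw [Subtype.ext_iff, ← x.2.choose_spec, ← y.2.choose_spec]
      exact congrArg b hxy
    · intro x
      have hx := x.2.choose_spec
      exact hx ▸ hbmem _
  -- the private element of a set that meets a circuit is spanned by this circuit
  have hcl : ∀ C, M.IsCircuit C → ∀ i, ∀ x ∈ C, x ∈ A i → b i ∈ M.closure C := by
    intro C hC i x hx hxi
    by_contra hbC
    have hbC' : b i ∉ C := fun h => hbC (M.subset_closure C hC.subset_ground h)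
    have hI : M.Indep (insert (b i) (C \ {x})) := by
      rw [← hC.closure_sdiff_singleton_eq x] at hbC
      exact ((hC.sdiff_singleton_indep hx).notMem_closure_iff_of_notMem
        (fun h => hbC' h.1) (hAE i (hbmem i))).1 hbC
    -- A matching of this set must send `b i` to `i`; since `x ∈ A i`, replacing `b i` by `x`
    -- matches all of the circuit `C`.
    obtain ⟨-, ψ, hψ, hψA⟩ := (hA _).1 hI
    refine hC.not_indep ((hA C).2 ⟨hC.subset_ground, ?_⟩)
    classical
    let f : α → α := fun y => if y = x then b i else y
    have hfx : f x = b i := if_pos rfl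
    have hfne : ∀ y, y ≠ x → f y = y := fun y hy => if_neg hy
    have hmem : ∀ y : C, f y ∈ insert (b i) (C \ {x}) := by
      intro y
      by_cases hy : (y : α) = x
      · simp [hy, hfx]
      · exact mem_insert_of_mem _ (by rw [hfne _ hy]; exact ⟨y.2, hy⟩)
    refine ⟨fun y => ψ ⟨_, hmem y⟩, fun y z hyz => ?_, fun y => ?_⟩
    · have h1 : f y = f z := congrArg Subtype.val (hψ hyz)
      by_cases hy : (y : α) = x <;> by_cases hz : (z : α) = x
      · exact Subtype.ext (hy.trans hz.symm)
      · rw [hy, hfx, hfne _ hz] at h1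
        exact absurd (h1 ▸ z.2) hbC'
      · rw [hz, hfx, hfne _ hy] at h1
        exact absurd (h1 ▸ y.2) hbC'
      · rw [hfne _ hy, hfne _ hz] at h1
        exact Subtype.ext h1
    · have h1 : f y ∈ A (ψ ⟨f y, hmem y⟩) := hψA ⟨f y, hmem y⟩
      change (y : α) ∈ A (ψ ⟨f y, hmem y⟩)
      generalize ψ ⟨f y, hmem y⟩ = k at h1 ⊢
      by_cases hy : (y : α) = x
      · rw [hy, hfx] at h1
        rwa [hy, hbA i k h1]
      · rwa [hfne _ hy] at h1
  refine ⟨range b, hB, fun F hF e he => ?_⟩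
  obtain ⟨C, hCF, hC, heC⟩ := (isCyclicFlat_iff.1 hF).2 e he
  have hsub : b '' {i | (C ∩ A i).Nonempty} ⊆ range b ∩ F := by
    rintro _ ⟨i, ⟨x, hx, hxi⟩, rfl⟩
    refine ⟨mem_range_self i, ?_⟩
    rw [← hF.1.closure]
    exact M.closure_subset_closure hCF (hcl C hC i x hx hxi)
  refine M.closure_subset_closure hsub ?_
  -- If adding `e` keeps independence, a matching sends `e` to some `i` whose set meets `C` at `e`.
  -- Then `b i` is also present and can only go to `i`, so `e = b i`.
  refine (hB.subset (image_subset_range _ _)).mem_closure_iff'.2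
    ⟨hC.subset_ground heC, fun hins => ?_⟩
  obtain ⟨-, ψ, hψ, hψA⟩ := (hA _).1 hins
  have hei := hψA ⟨e, mem_insert _ _⟩
  set i := ψ ⟨e, mem_insert _ _⟩ with hi
  have him : b i ∈ b '' {i | (C ∩ A i).Nonempty} := ⟨i, ⟨e, heC, hei⟩, rfl⟩
  have h1 : ψ ⟨b i, mem_insert_of_mem _ him⟩ = i := hbA i _ (hψA ⟨b i, mem_insert_of_mem _ him⟩)
  have h2 := congrArg Subtype.val (hψ (h1.trans hi))
  simp only at h2
  rwa [← h2]

/-- An independent set that spans every cyclic flat from within, once extended to a base `B`, yields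
the presentation by the complements of the hyperplanes `cl(B ∖ b)`. -/
theorem IsFundamentalTransversal.of_indep {M : Matroid α} [M.Finite] {B₀ : Set α}
    (hB₀ : M.Indep B₀) (h₀ : ∀ F, M.IsCyclicFlat F → F ⊆ M.closure (B₀ ∩ F)) :
    M.IsFundamentalTransversal := by
  obtain ⟨B, hB, hB₀B⟩ := hB₀.exists_isBase_superset
  have h : ∀ F, M.IsCyclicFlat F → F ⊆ M.closure (B ∩ F) := fun F hF =>
    (h₀ F hF).trans (M.closure_subset_closure (inter_subset_inter_left _ hB₀B))
  have hBf : B.Finite := M.set_finite B hB.subset_ground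
  have : Finite B := hBf
  let A : B → Set α := fun b => M.E \ M.closure (B \ {(b : α)})
  have hpres : ∀ I, M.Indep I ↔ I ⊆ M.E ∧ IsPartialTransversal A I := by
    refine fun I => ⟨fun hI => ⟨hI.subset_ground, ?_⟩, fun ⟨hIE, φ, hφ, hφA⟩ => ?_⟩
    · classical
      have := Fintype.ofFinite B
      -- Hall's condition holds because `J` is independent and spanned by the set of neighbours `S`.
      refine (Fintype.all_card_le_filter_rel_iff_exists_injective
        (fun (x : I) (b : B) => (x : α) ∈ A b)).1 fun J => ?_
      set S : Finset B := {b | ∃ x ∈ J, (x : α) ∈ A b} with hS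
      set J' : Set α := (↑) '' (J : Set I) with hJ'
      set S' : Set α := (↑) '' (S : Set B) with hS'
      have hJc : J'.encard = J.card := by
        rw [hJ', Subtype.val_injective.encard_image, encard_coe_eq_coe_finsetCard]
      have hSc : S'.encard = S.card := by
        rw [hS', Subtype.val_injective.encard_image, encard_coe_eq_coe_finsetCard]
      have hJI : J' ⊆ I := by simp [hJ']
      have hSB : S' ⊆ B := by simp [hS']
      -- For `b` outside `S'`, no element of `J` lies in `A b`, so `J' ⊆ cl(B \ b)`; these closures
      -- intersect in `cl S'`. If there is no such `b`, then `S'` is the whole base.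
      have hJS : J' ⊆ M.closure S' := by
        by_cases hne : (B \ S').Nonempty
        · have hcl := hB.indep.closure_sInter_eq_biInter_closure_of_forall_subset
            (Js := (fun b => B \ {b}) '' (B \ S')) (hne.image _)
            (by rintro _ ⟨b, -, rfl⟩; exact sdiff_subset)
          have hInt : ⋂₀ ((fun b => B \ {b}) '' (B \ S')) = S' := by
            obtain ⟨c, hc⟩ := hne
            ext x
            simp only [sInter_image, mem_iInter, mem_sdiff, mem_singleton_iff]
            refine ⟨fun hx => ?_, fun hx b hb => ⟨hSB hx, fun hxb => hb.2 (hxb ▸ hx)⟩⟩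
            by_contra hxS
            exact (hx x ⟨(hx c hc).1, hxS⟩).2 rfl
          rw [hInt] at hcl
          rw [hcl]
          simp only [biInter_image, subset_iInter_iff]
          intro b hb x hx
          by_contra hxb
          obtain ⟨y, hy, rfl⟩ := hx
          refine hb.2 ⟨⟨b, hb.1⟩, ?_, rfl⟩
          simp only [hS, Finset.coe_filter, Finset.mem_univ, true_and, mem_ofPred_eq]
          exact ⟨y, hy, hI.subset_ground y.2, hxb⟩
        · rw [not_nonempty_iff_eq_empty, sdiff_eq_empty] at hne
          rw [hSB.antisymm hne, hB.closure_eq]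
          exact hJI.trans hI.subset_ground
      have hle : J'.encard ≤ S'.encard := by
        rw [← (hI.subset hJI).eRk_eq_encard, ← (hB.indep.subset hSB).eRk_eq_encard,
          ← M.eRk_closure_eq S']
        exact M.eRk_mono hJS
      rw [hJc, hSc] at hle
      exact_mod_cast hle
    · by_contra hI
      obtain ⟨C, hCI, hC⟩ := ((not_indep_iff hIE).1 hI).exists_isCircuit_subset
      have hF := hC.isCyclicFlat_closure
      have hb := (hB.indep.subset inter_subset_left).isBasis_of_subset_of_subset_closure
        inter_subset_right (h _ hF)
      -- Otherwise `x ∈ cl(B ∩ cl C) ⊆ cl(B \ φ x)`, against `x ∈ A (φ x)`. Thus `C` would inject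
      -- into a set of size r(C) = |C| - 1.
      have hmem : ∀ x : C, (φ ⟨x, hCI x.2⟩ : α) ∈ B ∩ M.closure C := by
        refine fun x => ⟨(φ ⟨x, hCI x.2⟩).2, ?_⟩
        by_contra hn
        refine (hφA ⟨x, hCI x.2⟩).2 (M.closure_subset_closure ?_
          (h _ hF (M.subset_closure C hC.subset_ground x.2)))
        exact fun y hy => ⟨hy.1, fun hyn => hn (hyn ▸ hy.2)⟩
      have hcard : C.encard ≤ (B ∩ M.closure C).encard := by
        have hinj : Function.Injective
            (fun x : C => (⟨_, hmem x⟩ : (B ∩ M.closure C : Set α))) := by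
          intro x y hxy
          have h0 := congrArg (fun z : (B ∩ M.closure C : Set α) => (z : α)) hxy
          have := hφ (Subtype.val_injective h0)
          exact Subtype.ext (congrArg (fun z : I => (z : α)) this)
        exact ENat.card_le_card_of_injective hinj
      rw [← hb.eRk_eq_encard, M.eRk_closure_eq, ← hC.eRk_add_one_eq] at hcard
      exact absurd hcard (not_le.2 ((ENat.lt_add_one_iff
        (eRk_ne_top_iff.2 (M.isRkFinite_set C))).2 le_rfl))
  obtain ⟨n, ⟨e⟩⟩ := Finite.exists_equiv_fin B
  refine ⟨n, A ∘ e.symm, ⟨fun i => sdiff_subset, fun I => ?_⟩, fun i => ⟨e.symm i, ?_, ?_⟩⟩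
  · rw [hpres, IsPartialTransversal.comp_equiv]
  · exact ⟨hB.subset_ground (e.symm i).2, hB.indep.notMem_closure_sdiff_of_mem (e.symm i).2⟩
  · simp only [mem_iUnion, not_exists]
    intro j hj hmem
    refine hmem.2 (M.subset_closure _ (sdiff_subset.trans hB.subset_ground) ⟨(e.symm i).2, ?_⟩)
    rw [mem_singleton_iff, Subtype.val_inj]
    exact fun hij => hj (e.symm.injective hij).symm

/-! ### From Mason's function to a spanning independent set -/

theorem exists_indep_of_sum_masonAlpha {M : Matroid α} [M.Finite]
    (h : ∀ 𝓕 : Finset (Set α), M.IsCyclicFlatIdeal 𝓕 →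
      ∑ Y ∈ 𝓕, M.masonAlpha Y = M.intNullity (⋃₀ (𝓕 : Set (Set α)))) :
    ∃ B, M.Indep B ∧ ∀ F, M.IsCyclicFlat F → F ⊆ M.closure (B ∩ F) := by
  classical
  have hE : ∀ F, M.IsCyclicFlat F → F ⊆ M.E := fun F hF => hF.1.subset_ground
  -- the union of the cyclic flats that do not contain `I`
  let U : Set α → Finset (Set α) := fun I => M.cyclicFlats.filter (¬ I ⊆ ·)
  have hUE : ∀ I, ⋃₀ (U I : Set (Set α)) ⊆ M.E := fun I =>
    sUnion_subset fun F hF => hE F (by simp [U] at hF; exact hF.1)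
  -- Both `U I` and `insert I (U I)` are ideals; their two identities differ by α(I) alone.
  have hα : ∀ I, M.IsCyclicFlat I → M.masonAlpha I =
      M.intNullity (I ∪ ⋃₀ (U I : Set (Set α))) - M.intNullity (⋃₀ (U I : Set (Set α))) := by
    intro I hI
    have h1 := h (U I) ⟨fun F hF => by simp [U] at hF; exact hF.1, fun B hB A hA hAB => by
      simp only [U, Finset.mem_filter, mem_cyclicFlats] at hB ⊢
      exact ⟨hA, fun hIA => hB.2 (hIA.trans hAB)⟩⟩
    have h2 := h (insert I (U I)) ⟨fun F hF => by
        simp only [U, Finset.mem_insert, Finset.mem_filter, mem_cyclicFlats] at hF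
        rcases hF with rfl | hF
        exacts [hI, hF.1], fun B hB A hA hAB => by
      simp only [U, Finset.mem_insert, Finset.mem_filter, mem_cyclicFlats] at hB ⊢
      by_cases hIA : I ⊆ A
      · rcases hB with rfl | hB
        exacts [.inl (hAB.antisymm hIA), absurd (hIA.trans hAB) hB.2]
      · exact .inr ⟨hA, hIA⟩⟩
    rw [Finset.sum_insert (by simp [U]), Finset.coe_insert, sUnion_insert] at h2
    linarith
  have hex : ∀ I, M.IsCyclicFlat I → ∃ N : Finset α,
      (N : Set α) ⊆ I \ ⋃₀ (U I : Set (Set α)) ∧ (N.card : ℤ) = M.masonAlpha I := by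
    intro I hI
    have hsub := union_subset (hE I hI) (hUE I)
    have h0 := M.intNullity_mono subset_union_right hsub
    have hle : M.masonAlpha I ≤ ((I \ ⋃₀ (U I : Set (Set α))).ncard : ℤ) := by
      have h1 := M.intRk_mono (subset_union_right (s := I) (t := ⋃₀ (U I : Set (Set α))))
      have h2 := ncard_sdiff_add_ncard I (⋃₀ (U I : Set (Set α))) (M.set_finite I (hE I hI))
        (M.set_finite _ (hUE I))
      rw [hα I hI, intNullity, intNullity]
      omega
    obtain ⟨n, hn⟩ := Int.eq_ofNat_of_zero_le (a := M.masonAlpha I) (by rw [hα I hI]; linarith)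
    rw [hn, Nat.cast_le] at hle
    obtain ⟨N, hN, hNc⟩ := exists_subset_card_eq hle
    have hNf : N.Finite := (M.set_finite I (hE I hI)).subset (hN.trans sdiff_subset)
    refine ⟨hNf.toFinset, by simpa using hN, ?_⟩
    rw [hn, ← ncard_eq_toFinset_card N hNf, hNc]
  choose! N hN hNc using hex
  -- Consequently the sets `N I` are pairwise disjoint, and `T ∩ F` is the union of those with `I ⊆
  -- F`.
  have hNI : ∀ I J, M.IsCyclicFlat I → M.IsCyclicFlat J → ∀ x ∈ N I, x ∈ J → I ⊆ J := by
    intro I J hI hJ x hx hxJ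
    by_contra hIJ
    exact (hN I hI hx).2 ⟨J, by simp [U, hJ, hIJ], hxJ⟩
  have hNsub : ∀ I, M.IsCyclicFlat I → ∀ x ∈ N I, x ∈ I := fun I hI x hx => (hN I hI hx).1
  let T : Finset α := M.cyclicFlats.biUnion N
  have hT : ∀ F, M.IsCyclicFlat F → (((T : Set α) ∩ F).ncard : ℤ) = M.intNullity F := by
    intro F hF
    have h1 : (T : Set α) ∩ F = ((M.cyclicFlats.filter (· ⊆ F)).biUnion N : Finset α) := by
      ext x
      simp only [T, mem_inter_iff, Finset.mem_coe, Finset.mem_biUnion, Finset.mem_filter,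
        mem_cyclicFlats]
      constructor
      · rintro ⟨⟨I, hI, hx⟩, hxF⟩
        exact ⟨I, ⟨hI, hNI I F hI hF x hx hxF⟩, hx⟩
      · rintro ⟨I, ⟨hI, hIF⟩, hx⟩
        exact ⟨⟨I, hI, hx⟩, hIF (hNsub I hI x hx)⟩
    rw [h1, ncard_coe_finset, Finset.card_biUnion, ← hF.1.sum_masonAlpha, Nat.cast_sum]
    · refine Finset.sum_congr rfl fun I hI => ?_
      simp only [Finset.mem_filter, mem_cyclicFlats] at hI
      exact hNc I hI.1
    · intro I hI J hJ hne
      rw [Finset.mem_coe, Finset.mem_filter, mem_cyclicFlats] at hI hJ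
      refine Finset.disjoint_left.2 fun x hxI hxJ => hne (subset_antisymm ?_ ?_)
      · exact hNI I J hI.1 hJ.1 x hxI (hNsub J hJ.1 x hxJ)
      · exact hNI J I hJ.1 hI.1 x hxJ (hNsub I hI.1 x hxI)
  have hrk : ∀ F, M.IsCyclicFlat F → (((M.E \ T) ∩ F).ncard : ℤ) = M.intRk F := by
    intro F hF
    have h1 : (M.E \ T) ∩ F = F \ (T ∩ F) := by
      ext x
      exact ⟨fun hx => ⟨hx.2, fun h => hx.1.2 h.1⟩, fun hx =>
        ⟨⟨hE F hF hx.1, fun h => hx.2 ⟨h, hx.1⟩⟩, hx.1⟩⟩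
    have h2 := ncard_sdiff_add_ncard_of_subset (inter_subset_right (s := (T : Set α)) (t := F))
      (M.set_finite F (hE F hF))
    have h3 := hT F hF
    rw [intNullity] at h3
    rw [h1]
    omega
  -- A circuit `C` avoiding `T` would give |C| ≤ |(E \ T) ∩ cl C| = r(C) = |C| - 1.
  have hind : M.Indep (M.E \ T) := by
    by_contra hn
    obtain ⟨C, hCB, hC⟩ := ((not_indep_iff sdiff_subset).1 hn).exists_isCircuit_subset
    have hCf := M.set_finite C hC.subset_ground
    have h1 := hrk _ hC.isCyclicFlat_closure
    have h2 := ncard_le_ncard (subset_inter hCB (M.subset_closure C hC.subset_ground))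
      (M.ground_finite.subset (inter_subset_left.trans sdiff_subset))
    obtain ⟨e, he⟩ := hC.nonempty
    have h3 := ncard_sdiff_singleton_add_one he hCf
    rw [intRk, M.eRk_closure_eq, ← intRk, (hC.sdiff_singleton_isBasis he).intRk_eq_ncard] at h1
    omega
  refine ⟨M.E \ T, hind, fun F hF => ?_⟩
  have hI := hind.subset (inter_subset_left (s := M.E \ T) (t := F))
  have hIf := M.set_finite _ hI.subset_ground
  refine (hI.isBasis_of_eRk_ge hIf inter_subset_right ?_ (hE F hF)).subset_closure
  have h1 := hrk F hF
  rw [intRk, Nat.cast_inj, ncard_def] at h1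
  rw [hI.eRk_eq_encard, ← ENat.natCast_toNat hIf.encard_lt_top.ne, h1,
    ENat.natCast_toNat (eRk_ne_top_iff.2 (M.isRkFinite_set F))]

end Matroid

theorem theorem5p2 {α : Type*} (M : Matroid α) [M.Finite] :
    List.TFAE [
      M.IsFundamentalTransversal,
      ∀ 𝓕 : Finset (Set α), M.IsCyclicFlatSet 𝓕 → M.RankUnionEq 𝓕,
      ∀ 𝓕 : Finset (Set α), M.IsCyclicFlatIdeal 𝓕 → M.RankUnionEq 𝓕,
      ∀ 𝓕 : Finset (Set α), M.IsCyclicFlatAntichain 𝓕 → M.RankUnionEq 𝓕,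
      ∀ 𝓕 : Finset (Set α), M.IsCyclicFlatIdeal 𝓕 →
        ∑ Y ∈ 𝓕, M.masonAlpha Y = M.intNullity (⋃₀ (𝓕 : Set (Set α)))] := by
  tfae_have 1 → 2 := fun h 𝓕 h𝓕 => by
    obtain ⟨B, hB, hBF⟩ := h.exists_indep
    exact hB.rankUnionEq hBF h𝓕
  tfae_have 2 → 4 := fun h 𝓕 h𝓕 => h 𝓕 h𝓕.1
  tfae_have 4 → 3 := fun h 𝓕 h𝓕 => Matroid.rankUnionEq_of_antichain h 𝓕 h𝓕.1
  tfae_have 3 → 5 := fun h 𝓕 h𝓕 => h𝓕.sum_masonAlpha (h 𝓕 h𝓕)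
  tfae_have 5 → 1 := fun h => by
    obtain ⟨B, hB, hBF⟩ := Matroid.exists_indep_of_sum_masonAlpha h
    exact .of_indep hB hBF
  tfae_finish
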